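/- Let $X$ be a separable infinite-dimensional real or complex Banach space and let $N\ge 2$. For bounded linear operators $T_1,\dots,T_N$ on $X$, let $\text{d-}\mathcal{HC}(T_1,\dots,T_N)$ denote the set of d-hypercyclic vectors, i.e. of all $x\in X$ for which $\{(T_1^n x,\dots,T_N^n x): n\in\mathbb{N}\}$ is dense in $X^N$; the operators are densely d-hypercyclic if this set is dense in $X$, and a d-hypercyclic manifold is a (not necessarily closed) linear subspace of $X$ all of whose nonzero vectors are d-hypercyclic. Then there exist bounded linear operators $T_1,\dots,T_N$ on $X$ which are densely d-hypercyclic, which have no d-hypercyclic manifold that is dense in $X$, and for which every nonzero linear subspace of $X$ contained in $\text{d-}\mathcal{HC}(T_1,\dots,T_N)\cup\{0\}$ is one-dimensional. -/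

import Mathlib

/-- The set of d-hypercyclic vectors of the operators `T 0, …, T (N - 1)`: the vectors `x` for which
the joint orbit `{(T 0 ^ n x, …, T (N - 1) ^ n x) : n ∈ ℕ}` is dense in `X ^ N`
(with the product topology). -/
def dHypercyclicVectors {𝕜 : Type*} [RCLike 𝕜] {X : Type*} [NormedAddCommGroup X]
    [NormedSpace 𝕜 X] {N : ℕ} (T : Fin N → X →L[𝕜] X) : Set X :=
  {x | Dense (Set.range fun n : ℕ => fun i : Fin N => (T i ^ n) x)}

/-- The operators are densely d-hypercyclic if their d-hypercyclic vectors are dense in `X`. -/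
def DenselyDHypercyclic {𝕜 : Type*} [RCLike 𝕜] {X : Type*} [NormedAddCommGroup X]
    [NormedSpace 𝕜 X] {N : ℕ} (T : Fin N → X →L[𝕜] X) : Prop :=
  Dense (dHypercyclicVectors T)

/-- A d-hypercyclic manifold of the operators: a linear subspace (not necessarily closed) in which
every nonzero vector is d-hypercyclic. -/
def IsDHypercyclicManifold {𝕜 : Type*} [RCLike 𝕜] {X : Type*} [NormedAddCommGroup X]
    [NormedSpace 𝕜 X] {N : ℕ} (T : Fin N → X →L[𝕜] X) (V : Submodule 𝕜 X) : Prop :=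
  ∀ x ∈ V, x ≠ 0 → x ∈ dHypercyclicVectors T

/-!
On a separable infinite-dimensional Banach space, a biorthogonal sequence with dense span carries a
weighted backward shift `S`. Normalised suitably, the sequence is the image of the monomials under a
linear map `Φ : 𝕜[X] → E` with `S ∘ Φ = Φ ∘ d/dX`, so `exp S` acts on the range of `Φ` as the
translation `p(X) ↦ p(X + 1)`; this makes `A = exp S` topologically mixing.

By transitivity of the powers of `A` there are `w, e₁, …, e_N` with dense joint orbit. Choose a
functional `f ≠ 0` killing every `eᵢ` and conjugate `A` by the transvections `Lᵢ x = x + f(x) eᵢ` to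
get `Tᵢ`. In the coordinates `Lᵢ` the joint orbit of `x` is `(Aⁿ x + f(x) Aⁿ eᵢ)ᵢ`. It stays in the
diagonal if `f x = 0`, so a d-hypercyclic manifold meets `ker f` trivially; and it is dense if
`x = Aᵏ w` with `f x ≠ 0`, because `(z₀, zᵢ) ↦ Aᵏ z₀ + f(x) zᵢ` is onto. Such `x` form a dense set.
-/

open Filter Topology Polynomial Bornology

/-! ### Biorthogonal sequences -/

section Biorthogonalize

variable {R M : Type*} [CommRing R] [AddCommGroup M] [Module R M]

/-- The triangular (Gram–Schmidt type) modification of a sequence `d`: from `d n` the components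
along the earlier terms are subtracted, as measured by the functionals `f`. If `f` is unitriangular
on `d`, the new sequence is biorthogonal to `f`. -/
noncomputable def biorthogonalize (d : ℕ → M) (f : ℕ → Module.Dual R M) : ℕ → M
  | n => d n - ∑ i : Fin n, f i (d n) • biorthogonalize d f i

variable {d : ℕ → M} {f : ℕ → Module.Dual R M}

theorem dual_biorthogonalize (m n : ℕ) :
    f m (biorthogonalize d f n) =
      f m (d n) - ∑ i : Fin n, f i (d n) * f m (biorthogonalize d f i) := by
  rw [biorthogonalize]
  simp only [map_sub, map_sum, map_smul, smul_eq_mul]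

theorem dual_biorthogonalize_of_lt (hlt : ∀ m n, n < m → f m (d n) = 0) {m n : ℕ} (hnm : n < m) :
    f m (biorthogonalize d f n) = 0 := by
  induction n using Nat.strong_induction_on with
  | _ n ih =>
    rw [dual_biorthogonalize, hlt m n hnm, Finset.sum_eq_zero, sub_zero]
    intro i _
    rw [ih i i.2 (i.2.trans hnm), mul_zero]

theorem dual_biorthogonalize_self (hone : ∀ n, f n (d n) = 1)
    (hlt : ∀ m n, n < m → f m (d n) = 0) (n : ℕ) : f n (biorthogonalize d f n) = 1 := by
  rw [dual_biorthogonalize, hone, Finset.sum_eq_zero, sub_zero]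
  intro i _
  rw [dual_biorthogonalize_of_lt hlt i.2, mul_zero]

theorem dual_biorthogonalize_of_gt (hone : ∀ n, f n (d n) = 1)
    (hlt : ∀ m n, n < m → f m (d n) = 0) {m n : ℕ} (hmn : m < n) :
    f m (biorthogonalize d f n) = 0 := by
  induction n using Nat.strong_induction_on with
  | _ n ih =>
    rw [dual_biorthogonalize, Finset.sum_eq_single (⟨m, hmn⟩ : Fin n)]
    · rw [dual_biorthogonalize_self hone hlt, mul_one, sub_self]
    · intro i _ hi
      rcases lt_or_gt_of_ne (Fin.val_ne_of_ne hi) with him | hmi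
      · rw [dual_biorthogonalize_of_lt hlt him, mul_zero]
      · rw [ih i i.2 hmi, mul_zero]
    · simp

theorem dual_biorthogonalize_eq_single (hone : ∀ n, f n (d n) = 1)
    (hlt : ∀ m n, n < m → f m (d n) = 0) (m n : ℕ) :
    f m (biorthogonalize d f n) = Pi.single (M := fun _ => R) m 1 n := by
  rcases lt_trichotomy m n with hmn | rfl | hnm
  · rw [dual_biorthogonalize_of_gt hone hlt hmn, Pi.single_eq_of_ne hmn.ne']
  · rw [dual_biorthogonalize_self hone hlt, Pi.single_eq_same]
  · rw [dual_biorthogonalize_of_lt hlt hnm, Pi.single_eq_of_ne hnm.ne]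

theorem span_le_span_biorthogonalize :
    Submodule.span R (Set.range d) ≤ Submodule.span R (Set.range (biorthogonalize d f)) := by
  rw [Submodule.span_le]
  rintro _ ⟨n, rfl⟩
  have hn : d n = biorthogonalize d f n + ∑ i : Fin n, f i (d n) • biorthogonalize d f i := by
    rw [biorthogonalize, sub_add_cancel]
  rw [hn]
  exact add_mem (Submodule.subset_span ⟨n, rfl⟩) (Submodule.sum_mem _ fun i _ =>
    Submodule.smul_mem _ _ (Submodule.subset_span ⟨i, rfl⟩))

end Biorthogonalize

section TopologicalVectorSpace

variable {𝕜 E : Type*} [NontriviallyNormedField 𝕜] [CompleteSpace 𝕜] [AddCommGroup E]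
  [TopologicalSpace E] [IsTopologicalAddGroup E] [Module 𝕜 E] [ContinuousSMul 𝕜 E] [T2Space E]

theorem finiteDimensional_of_dense_submodule {V : Submodule 𝕜 E} [FiniteDimensional 𝕜 V]
    (hV : Dense (V : Set E)) : FiniteDimensional 𝕜 E := by
  obtain rfl : V = ⊤ := by
    rw [← V.closed_of_finiteDimensional.submodule_topologicalClosure_eq,
      Submodule.dense_iff_topologicalClosure_eq_top.1 hV]
  exact Module.Finite.equiv Submodule.topEquiv

theorem exists_linearIndependent_nat_dense_span [TopologicalSpace.SeparableSpace E]
    (hE : ¬ FiniteDimensional 𝕜 E) :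
    ∃ d : ℕ → E, LinearIndependent 𝕜 d ∧ Dense (Submodule.span 𝕜 (Set.range d) : Set E) := by
  obtain ⟨s, hs_countable, hs_dense⟩ := TopologicalSpace.exists_countable_dense E
  obtain ⟨b, hbs, hspan, hb⟩ := exists_linearIndependent 𝕜 s
  have hb_dense : Dense (Submodule.span 𝕜 b : Set E) :=
    hspan ▸ hs_dense.mono Submodule.subset_span
  have : Infinite b := Set.infinite_coe_iff.2 fun hfin => by
    have := FiniteDimensional.span_of_finite 𝕜 hfin
    exact hE (finiteDimensional_of_dense_submodule hb_dense)
  have : Countable b := (hs_countable.mono hbs).to_subtype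
  obtain ⟨e⟩ : Nonempty (ℕ ≃ b) := nonempty_equiv_of_countable
  refine ⟨Subtype.val ∘ e, hb.comp e e.injective, ?_⟩
  rwa [EquivLike.range_comp, Subtype.range_coe]

end TopologicalVectorSpace

section Functionals

variable {𝕜 E : Type*} [RCLike 𝕜] [NormedAddCommGroup E] [NormedSpace 𝕜 E]

theorem exists_strongDual_eq_one_of_notMem {p : Submodule 𝕜 E} (hp : IsClosed (p : Set E)) {x : E}
    (hx : x ∉ p) : ∃ f : StrongDual 𝕜 E, (∀ y ∈ p, f y = 0) ∧ f x = 1 := by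
  obtain ⟨g, hg⟩ := SeparatingDual.exists_eq_one (R := 𝕜) (x := p.mkQ x) (by simpa using hx)
  refine ⟨g.comp p.mkQL, fun y hy => ?_, hg⟩
  have hy0 : p.mkQL y = 0 := (Submodule.Quotient.mk_eq_zero p).2 hy
  rw [ContinuousLinearMap.comp_apply, hy0, map_zero]

theorem exists_strongDual_ne_zero_of_finite (hE : ¬ FiniteDimensional 𝕜 E) {s : Set E}
    (hs : s.Finite) : ∃ f : StrongDual 𝕜 E, f ≠ 0 ∧ ∀ y ∈ s, f y = 0 := by
  have : FiniteDimensional 𝕜 (Submodule.span 𝕜 s) := FiniteDimensional.span_of_finite 𝕜 hs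
  obtain ⟨x, hx⟩ : ∃ x, x ∉ Submodule.span 𝕜 s := by
    by_contra! h
    exact hE (finiteDimensional_of_dense_submodule fun x => subset_closure (h x))
  obtain ⟨f, hf, hfx⟩ :=
    exists_strongDual_eq_one_of_notMem (Submodule.closed_of_finiteDimensional _) hx
  refine ⟨f, ?_, fun y hy => hf y (Submodule.subset_span hy)⟩
  rintro rfl
  exact zero_ne_one hfx

theorem exists_unitriangular_strongDual {d : ℕ → E} (hd : LinearIndependent 𝕜 d) :
    ∃ f : ℕ → StrongDual 𝕜 E, (∀ n, f n (d n) = 1) ∧ ∀ m n, n < m → f m (d n) = 0 := by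
  have hf (m : ℕ) : ∃ f : StrongDual 𝕜 E,
      (∀ y ∈ Submodule.span 𝕜 (d '' Set.Iio m), f y = 0) ∧ f (d m) = 1 := by
    have : FiniteDimensional 𝕜 (Submodule.span 𝕜 (d '' Set.Iio m)) :=
      FiniteDimensional.span_of_finite 𝕜 ((Set.finite_Iio m).image d)
    exact exists_strongDual_eq_one_of_notMem (Submodule.closed_of_finiteDimensional _)
      (hd.notMem_span_image Set.self_notMem_Iio)
  choose f hf_zero hf_one using hf
  exact ⟨f, hf_one, fun m n hnm => hf_zero m _ (Submodule.subset_span ⟨n, hnm, rfl⟩)⟩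

theorem exists_biorthogonal_dense_span [TopologicalSpace.SeparableSpace E]
    (hE : ¬ FiniteDimensional 𝕜 E) :
    ∃ (x : ℕ → E) (f : ℕ → StrongDual 𝕜 E),
      (∀ m n, f m (x n) = Pi.single (M := fun _ => 𝕜) m 1 n) ∧
      Dense (Submodule.span 𝕜 (Set.range x) : Set E) := by
  obtain ⟨d, hd, hd_dense⟩ := exists_linearIndependent_nat_dense_span hE
  obtain ⟨f, hone, hlt⟩ := exists_unitriangular_strongDual hd
  exact ⟨biorthogonalize d fun n => (f n : E →ₗ[𝕜] 𝕜), f,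
    dual_biorthogonalize_eq_single (f := fun n => (f n : E →ₗ[𝕜] 𝕜)) hone hlt,
    hd_dense.mono span_le_span_biorthogonalize⟩

end Functionals

/-! ### Weighted backward shifts -/

section BackwardShift

variable {𝕜 E : Type*} [RCLike 𝕜] [NormedAddCommGroup E] [NormedSpace 𝕜 E] [CompleteSpace E]

theorem exists_ne_zero_summable_smul (v : ℕ → E) :
    ∃ c : ℕ → 𝕜, (∀ n, c n ≠ 0) ∧ Summable fun n => c n • v n := by
  have hpos (n : ℕ) : 0 < (1 / 2 : ℝ) ^ n / (‖v n‖ + 1) := by positivity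
  refine ⟨fun n => (((1 / 2 : ℝ) ^ n / (‖v n‖ + 1) : ℝ) : 𝕜),
    fun n => RCLike.ofReal_ne_zero.2 (hpos n).ne', .of_norm_bounded summable_geometric_two
      fun n => ?_⟩
  rw [norm_smul, RCLike.norm_of_nonneg (hpos n).le, div_mul_eq_mul_div,
    div_le_iff₀ (by positivity)]
  gcongr
  exact le_add_of_nonneg_right zero_le_one

theorem exists_weighted_backward_shift {x : ℕ → E} {f : ℕ → StrongDual 𝕜 E}
    (hfx : ∀ m n, f m (x n) = Pi.single (M := fun _ => 𝕜) m 1 n) :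
    ∃ (S : E →L[𝕜] E) (c : ℕ → 𝕜), (∀ n, c n ≠ 0) ∧ S (x 0) = 0 ∧
      ∀ n, S (x (n + 1)) = c n • x n := by
  obtain ⟨c, hc, hsum⟩ :=
    exists_ne_zero_summable_smul (𝕜 := 𝕜) fun n => (f (n + 1)).smulRight (x n)
  have hS (v : E) :
      (∑' n, c n • (f (n + 1)).smulRight (x n)) v = ∑' n, c n • f (n + 1) v • x n :=
    (ContinuousLinearMap.apply 𝕜 E v).map_tsum hsum
  refine ⟨∑' n, c n • (f (n + 1)).smulRight (x n), c, hc, ?_, fun n => ?_⟩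
  · simp [hS, hfx]
  · rw [hS, tsum_eq_single n]
    · simp [hfx]
    · intro m hm
      simp [hfx, hm.symm]

end BackwardShift

/-- A weighted backward shift is a copy of `d/dX`: the weights are absorbed by rescaling the image
of each monomial. -/
theorem exists_polynomial_map_derivative_of_shift {𝕜 E : Type*} [Field 𝕜] [CharZero 𝕜]
    [AddCommGroup E] [Module 𝕜 E] {S : E →ₗ[𝕜] E} {x : ℕ → E} {c : ℕ → 𝕜} (hc : ∀ n, c n ≠ 0)
    (hzero : S (x 0) = 0) (hsucc : ∀ n, S (x (n + 1)) = c n • x n) :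
    ∃ Φ : 𝕜[X] →ₗ[𝕜] E, (∀ p, S (Φ p) = Φ (derivative p)) ∧
      Submodule.span 𝕜 (Set.range x) ≤ LinearMap.range Φ := by
  let a (n : ℕ) : 𝕜 := ∏ i ∈ Finset.range n, ((i + 1 : ℕ) : 𝕜) / c i
  have ha (n : ℕ) : a n ≠ 0 := Finset.prod_ne_zero_iff.2 fun i _ =>
    div_ne_zero (Nat.cast_ne_zero.2 i.succ_ne_zero) (hc i)
  have ha_succ (n : ℕ) : a (n + 1) * c n = (n + 1 : ℕ) * a n := by
    simp only [a, Finset.prod_range_succ]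
    field_simp [hc n]
  let Φ : 𝕜[X] →ₗ[𝕜] E := Polynomial.lsum fun n => LinearMap.toSpanSingleton 𝕜 E (a n • x n)
  have hΦ (n : ℕ) (b : 𝕜) : Φ (monomial n b) = b • a n • x n := by
    simp [Φ]
  refine ⟨Φ, fun p => ?_, Submodule.span_le.2 ?_⟩
  · induction p using Polynomial.induction_on' with
    | add p q hp hq => simp only [map_add, hp, hq]
    | monomial n b =>
      cases n with
      | zero =>
        rw [derivative_monomial, hΦ, map_smul, map_smul, hzero]
        simp
      | succ n =>
        rw [derivative_monomial, hΦ, hΦ, map_smul, map_smul, hsucc, smul_smul (a _), ha_succ,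
          Nat.add_sub_cancel]
        simp only [smul_smul, mul_assoc]
  · rintro _ ⟨n, rfl⟩
    exact ⟨monomial n (a n)⁻¹, by rw [hΦ, inv_smul_smul₀ (ha n)]⟩

/-! ### The exponential of a copy of `d/dX` -/

section TaylorPolynomial

theorem taylor_eq_sum_hasseDeriv {R : Type*} [CommSemiring R] (t : R) (p : R[X]) :
    taylor t p = ∑ k ∈ Finset.range (p.natDegree + 1), t ^ k • hasseDeriv k p := by
  ext n
  have hdeg : (hasseDeriv n p).natDegree < p.natDegree + 1 :=
    Nat.lt_succ_of_le ((natDegree_hasseDeriv_le p n).trans (Nat.sub_le _ _))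
  rw [taylor_coeff, eval_eq_sum_range' hdeg, finsetSum_coeff]
  refine Finset.sum_congr rfl fun k _ => ?_
  rw [hasseDeriv_coeff, coeff_smul, hasseDeriv_coeff, smul_eq_mul, mul_comm, add_comm k n,
    Nat.choose_symm_add]

theorem taylor_X_pow_mul_one_sub_pow {R : Type*} [CommRing R] {s t : R} (hst : s * t = 1) (k : ℕ) :
    taylor t (X ^ k * (1 - C s * X) ^ (k + 1)) =
      (-1) ^ (k + 1) * C s * X ^ (k + 1) * (1 + C s * X) ^ k := by
  have hC : (C s : R[X]) * C t = 1 := by rw [← C_mul, hst, C_1]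
  have hsub : 1 - C s * (X + C t) = -1 * (C s * X) := by rw [mul_add, hC]; ring
  have hadd : 1 + C s * X = C s * (X + C t) := by rw [mul_add, hC, add_comm]
  simp only [taylor_mul, taylor_pow, map_sub, taylor_one, taylor_C, taylor_X, C_1]
  rw [hsub, hadd]
  simp only [mul_pow]
  ring

theorem continuous_map_eval_C {R E : Type*} [CommSemiring R] [TopologicalSpace R]
    [IsTopologicalSemiring R] [AddCommMonoid E] [TopologicalSpace E] [ContinuousAdd E] [Module R E]
    [ContinuousSMul R E] (Φ : R[X] →ₗ[R] E) (P : R[X][X]) :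
    Continuous fun s : R => Φ (P.eval (C s)) := by
  have h (s : R) : Φ (P.eval (C s)) =
      ∑ i ∈ Finset.range (P.natDegree + 1), s ^ i • Φ (P.coeff i) := by
    rw [eval_eq_sum_range, map_sum]
    refine Finset.sum_congr rfl fun i _ => ?_
    rw [← C_pow, mul_comm, ← smul_eq_C_mul, map_smul]
  simp only [h]
  fun_prop

variable {𝕜 E α : Type*} [NormedField 𝕜] [AddCommGroup E] [TopologicalSpace E] [ContinuousAdd E]
  [Module 𝕜 E] [ContinuousSMul 𝕜 E] {l : Filter α} {t : α → 𝕜}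

theorem exists_tendsto_taylor_tendsto_zero (ht : Tendsto t l (cobounded 𝕜)) (Φ : 𝕜[X] →ₗ[𝕜] E)
    (p : 𝕜[X]) :
    ∃ r : α → 𝕜[X], Tendsto (fun a => Φ (r a)) l (𝓝 (Φ p)) ∧
      Tendsto (fun a => Φ (taylor (t a) (r a))) l (𝓝 0) := by
  induction p using Polynomial.induction_on' with
  | add p q hp hq =>
    obtain ⟨r, hr, hr'⟩ := hp
    obtain ⟨u, hu, hu'⟩ := hq
    exact ⟨r + u, by simpa using hr.add hu, by simpa using hr'.add hu'⟩
  | monomial k b =>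
    -- Damping `X ^ k` by `(1 - X / t) ^ (k + 1)` leaves a factor `1 / t` after translation by `t`.
    let P : 𝕜[X][X] := C (C b * X ^ k) * (1 - X * C X) ^ (k + 1)
    let Q : 𝕜[X][X] := C (C b * (-1) ^ (k + 1) * X ^ (k + 1)) * X * (1 + X * C X) ^ k
    have hs : Tendsto (fun a => (t a)⁻¹) l (𝓝 0) := tendsto_inv₀_cobounded.comp ht
    have hP : Tendsto (fun a => Φ (P.eval (C (t a)⁻¹))) l (𝓝 (Φ (P.eval (C 0)))) :=
      ((continuous_map_eval_C Φ P).tendsto 0).comp hs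
    have hQ : Tendsto (fun a => Φ (Q.eval (C (t a)⁻¹))) l (𝓝 (Φ (Q.eval (C 0)))) :=
      ((continuous_map_eval_C Φ Q).tendsto 0).comp hs
    have hPQ : ∀ᶠ a in l, Q.eval (C (t a)⁻¹) = taylor (t a) (P.eval (C (t a)⁻¹)) := by
      filter_upwards [ht.eventually_ne_cobounded 0] with a ha
      simp only [P, Q, eval_mul, eval_pow, eval_sub, eval_add, eval_one, eval_C, eval_X]
      rw [mul_assoc (C b) (X ^ k), taylor_mul, taylor_C,
        taylor_X_pow_mul_one_sub_pow (inv_mul_cancel₀ ha)]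
      ring
    refine ⟨fun a => P.eval (C (t a)⁻¹), ?_, ?_⟩
    · simpa [P, C_mul_X_pow_eq_monomial] using hP
    · simpa [Q] using hQ.congr' (hPQ.mono fun a ha => congrArg Φ ha)

theorem exists_tendsto_taylor_tendsto (ht : Tendsto t l (cobounded 𝕜)) (Φ : 𝕜[X] →ₗ[𝕜] E)
    (p q : 𝕜[X]) :
    ∃ r : α → 𝕜[X], Tendsto (fun a => Φ (r a)) l (𝓝 (Φ p)) ∧
      Tendsto (fun a => Φ (taylor (t a) (r a))) l (𝓝 (Φ q)) := by
  obtain ⟨r, hr, hr'⟩ := exists_tendsto_taylor_tendsto_zero ht Φ p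
  have ht_neg : Tendsto (fun a => -t a) l (cobounded 𝕜) := tendsto_neg_cobounded.comp ht
  obtain ⟨u, hu, hu'⟩ := exists_tendsto_taylor_tendsto_zero ht_neg Φ q
  refine ⟨fun a => r a + taylor (-t a) (u a), ?_, ?_⟩
  · simpa using hr.add hu'
  · simpa [taylor_taylor] using hr'.add hu

end TaylorPolynomial

theorem exp_smul_apply_eq_taylor {𝕜 E : Type*} [RCLike 𝕜] [NormedAddCommGroup E]
    [NormedSpace 𝕜 E] [CompleteSpace E] {S : E →L[𝕜] E} {Φ : 𝕜[X] →ₗ[𝕜] E}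
    (hΦ : ∀ p, S (Φ p) = Φ (derivative p)) (t : 𝕜) (p : 𝕜[X]) :
    (NormedSpace.exp (t • S) : E →L[𝕜] E) (Φ p) = Φ (taylor t p) := by
  have hpow (k : ℕ) : (S ^ k) (Φ p) = Φ (derivative^[k] p) := by
    rw [FunLike.coe_pow_eq_iterate]
    exact (Function.Semiconj.iterate_right (fun q => (hΦ q).symm) k p).symm
  have hterm (k : ℕ) :
      ((k.factorial : 𝕜)⁻¹ • (t • S) ^ k) (Φ p) = t ^ k • Φ (hasseDeriv k p) := by
    have hk : (k.factorial : 𝕜) ≠ 0 := Nat.cast_ne_zero.2 k.factorial_ne_zero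
    rw [_root_.smul_pow, smul_apply, smul_apply, hpow,
      ← factorial_smul_hasseDeriv, LinearMap.smul_apply, map_nsmul, smul_comm,
      ← Nat.cast_smul_eq_nsmul 𝕜, inv_smul_smul₀ hk]
  have hexp := (ContinuousLinearMap.apply 𝕜 E (Φ p)).hasSum
    (NormedSpace.exp_series_hasSum_exp' (𝕂 := 𝕜) (t • S))
  simp only [ContinuousLinearMap.apply_apply, hterm] at hexp
  rw [taylor_eq_sum_hasseDeriv, map_sum]
  simp only [map_smul]
  refine hexp.unique (hasSum_sum_of_ne_finset_zero fun k hk => ?_)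
  rw [hasseDeriv_eq_zero_of_lt_natDegree p k (by simpa using hk), map_zero, smul_zero]

/-! ### Topological mixing and dense joint orbits -/

/-- A self-map of a topological space is topologically mixing if, for all nonempty open sets `U` and
`V`, the iterates `T^[n] U` meet `V` for all large `n`. -/
def IsTopologicallyMixing {α : Type*} [TopologicalSpace α] (T : α → α) : Prop :=
  ∀ U V : Set α, IsOpen U → U.Nonempty → IsOpen V → V.Nonempty →
    ∀ᶠ n in atTop, (U ∩ T^[n] ⁻¹' V).Nonempty

namespace IsTopologicallyMixing

theorem of_dense {α : Type*} [TopologicalSpace α] {T : α → α} {D : Set α} (hD : Dense D)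
    (h : ∀ p ∈ D, ∀ q ∈ D, ∃ u : ℕ → α,
      Tendsto u atTop (𝓝 p) ∧ Tendsto (fun n => T^[n] (u n)) atTop (𝓝 q)) :
    IsTopologicallyMixing T := by
  intro U V hU hUne hV hVne
  obtain ⟨p, hpU, hpD⟩ := hD.inter_open_nonempty U hU hUne
  obtain ⟨q, hqV, hqD⟩ := hD.inter_open_nonempty V hV hVne
  obtain ⟨u, hu, hTu⟩ := h p hpD q hqD
  filter_upwards [hu.eventually_mem (hU.mem_nhds hpU), hTu.eventually_mem (hV.mem_nhds hqV)]
    with n hnU hnV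
  exact ⟨u n, hnU, hnV⟩

theorem piMap {ι : Type*} [Finite ι] {α : ι → Type*} [∀ i, TopologicalSpace (α i)]
    {T : ∀ i, α i → α i} (hT : ∀ i, IsTopologicallyMixing (T i)) :
    IsTopologicallyMixing (Pi.map T) := by
  rintro U V hU ⟨x, hx⟩ hV ⟨y, hy⟩
  obtain ⟨u, hu, huU⟩ := isOpen_pi_iff'.1 hU x hx
  obtain ⟨v, hv, hvV⟩ := isOpen_pi_iff'.1 hV y hy
  have hmeet : ∀ᶠ n in atTop, ∀ i, (u i ∩ (T i)^[n] ⁻¹' v i).Nonempty := eventually_all.2 fun i =>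
    hT i (u i) (v i) (hu i).1 ⟨x i, (hu i).2⟩ (hv i).1 ⟨y i, (hv i).2⟩
  filter_upwards [hmeet] with n hn
  choose z hzu hzv using hn
  refine ⟨z, huU fun i _ => hzu i, hvV fun i _ => ?_⟩
  rw [Pi.map_iterate]
  exact hzv i

end IsTopologicallyMixing

/-- Birkhoff transitivity, in the form of the universality criterion for families of maps. -/
theorem dense_setOf_dense_range {ι α β : Type*} [TopologicalSpace α] [BaireSpace α]
    [TopologicalSpace β] [SecondCountableTopology β] {F : ι → α → β} (hF : ∀ i, Continuous (F i))
    (h : ∀ U V, IsOpen U → U.Nonempty → IsOpen V → V.Nonempty → ∃ i, (U ∩ F i ⁻¹' V).Nonempty) :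
    Dense {x | Dense (Set.range fun i => F i x)} := by
  let B := TopologicalSpace.countableBasis β
  have hB : TopologicalSpace.IsTopologicalBasis B := TopologicalSpace.isBasis_countableBasis β
  have hopen : ∀ V ∈ B, IsOpen (⋃ i, F i ⁻¹' V) := fun V hV =>
    isOpen_iUnion fun i => (hB.isOpen hV).preimage (hF i)
  have hdense : ∀ V ∈ B, Dense (⋃ i, F i ⁻¹' V) := fun V hV =>
    dense_iff_inter_open.2 fun U hU hUne => by
      obtain ⟨i, x, hxU, hxV⟩ :=
        h U V hU hUne (hB.isOpen hV) (TopologicalSpace.nonempty_of_mem_countableBasis hV)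
      exact ⟨x, hxU, Set.mem_iUnion.2 ⟨i, hxV⟩⟩
  refine (dense_biInter_of_isOpen hopen (TopologicalSpace.countable_countableBasis β) hdense).mono
    fun x hx => hB.dense_iff.2 fun V hV _ => ?_
  obtain ⟨i, hi⟩ := Set.mem_iUnion.1 (Set.mem_iInter₂.1 hx V hV)
  exact ⟨F i x, hi, i, rfl⟩

theorem IsTopologicallyMixing.exists_dense_joint_orbit {α : Type*} [TopologicalSpace α]
    [SecondCountableTopology α] [Nonempty α] {T : α → α} (hT : IsTopologicallyMixing T)
    (hcont : Continuous T) (ι : Type*) [Finite ι] [BaireSpace (ι → α)] :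
    ∃ v : ι → α, Dense (Set.range fun (n : ℕ) (i : ι) => T^[n] (v i)) :=
  (dense_setOf_dense_range (F := fun (n : ℕ) (v : ι → α) i => T^[n] (v i))
    (fun n => by have := hcont.iterate n; fun_prop) fun U V hU hUne hV hVne => by
      obtain ⟨n, hn⟩ := (piMap (fun _ : ι => hT) U V hU hUne hV hVne).exists
      rw [Pi.map_iterate] at hn
      exact ⟨n, hn⟩).nonempty

section MixingOperator

variable {𝕜 E : Type*} [RCLike 𝕜] [NormedAddCommGroup E] [NormedSpace 𝕜 E] [CompleteSpace E]

theorem isTopologicallyMixing_exp {S : E →L[𝕜] E} {Φ : 𝕜[X] →ₗ[𝕜] E} (hΦ_dense : DenseRange Φ)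
    (hΦ : ∀ p, S (Φ p) = Φ (derivative p)) :
    IsTopologicallyMixing ⇑(NormedSpace.exp S : E →L[𝕜] E) := by
  let : NormedAlgebra ℚ (E →L[𝕜] E) := .restrictScalars ℚ 𝕜 (E →L[𝕜] E)
  have hiter (n : ℕ) (p : 𝕜[X]) : (NormedSpace.exp S : E →L[𝕜] E)^[n] (Φ p) =
      Φ (taylor (n : 𝕜) p) := by
    rw [← FunLike.coe_pow_eq_iterate, ← NormedSpace.exp_nsmul, ← Nat.cast_smul_eq_nsmul 𝕜,
      exp_smul_apply_eq_taylor hΦ]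
  refine .of_dense hΦ_dense ?_
  rintro _ ⟨p, rfl⟩ _ ⟨q, rfl⟩
  obtain ⟨r, hr, hr'⟩ := exists_tendsto_taylor_tendsto tendsto_natCast_atTop_cobounded Φ p q
  exact ⟨fun n => Φ (r n), hr, by simpa only [hiter] using hr'⟩

theorem exists_isTopologicallyMixing [TopologicalSpace.SeparableSpace E]
    (hE : ¬ FiniteDimensional 𝕜 E) : ∃ A : E →L[𝕜] E, IsTopologicallyMixing A := by
  obtain ⟨x, f, hfx, hx_dense⟩ := exists_biorthogonal_dense_span hE
  obtain ⟨S, c, hc, hzero, hsucc⟩ := exists_weighted_backward_shift hfx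
  obtain ⟨Φ, hΦ, hxΦ⟩ :=
    exists_polynomial_map_derivative_of_shift (S := (S : E →ₗ[𝕜] E)) hc hzero hsucc
  exact ⟨NormedSpace.exp S, isTopologicallyMixing_exp (hx_dense.mono hxΦ) hΦ⟩

end MixingOperator

/-! ### Conjugates by transvections -/

theorem not_dense_of_subset_diagonal {ι E : Type*} [Nontrivial ι] [TopologicalSpace E] [T2Space E]
    [Nontrivial E] {s : Set (ι → E)} (hs : ∀ z ∈ s, ∀ i j, z i = z j) : ¬ Dense s := by
  classical
  intro hdense
  obtain ⟨i, j, hij⟩ := exists_pair_ne ι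
  obtain ⟨x, y, hxy⟩ := exists_pair_ne E
  have hclosed : IsClosed {z : ι → E | z i = z j} :=
    isClosed_eq (continuous_apply i) (continuous_apply j)
  have hmem : Function.update (fun _ => x) j y ∈ {z : ι → E | z i = z j} :=
    hclosed.closure_subset_iff.2 (fun z hz => hs z hz i j) (hdense _)
  rw [Set.mem_ofPred_eq, Function.update_of_ne hij, Function.update_self] at hmem
  exact hxy hmem

theorem finrank_eq_one_of_forall_apply_ne_zero {K M : Type*} [Field K] [AddCommGroup M]
    [Module K M] (f : Module.Dual K M) {V : Submodule K M} (hV : V ≠ ⊥)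
    (h : ∀ x ∈ V, x ≠ 0 → f x ≠ 0) : Module.finrank K V = 1 := by
  have hinj : Function.Injective (f.domRestrict V) :=
    (injective_iff_map_eq_zero _).2 fun x hx => by
      by_contra hx0
      exact h x x.2 (by simpa using hx0) hx
  have : FiniteDimensional K V := FiniteDimensional.of_injective _ hinj
  refine le_antisymm ?_ (Submodule.one_le_finrank_iff.2 hV)
  simpa using LinearMap.finrank_le_finrank_of_injective hinj

theorem dense_setOf_strongDual_apply_ne_zero {𝕜 E : Type*} [NontriviallyNormedField 𝕜]
    [AddCommGroup E] [TopologicalSpace E] [ContinuousAdd E] [Module 𝕜 E] [ContinuousSMul 𝕜 E]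
    {f : StrongDual 𝕜 E} (hf : f ≠ 0) : Dense {x | f x ≠ 0} := by
  have hker : interior (LinearMap.ker (f : E →ₗ[𝕜] 𝕜) : Set E) = ∅ := by
    by_contra hne
    have := Submodule.eq_top_of_nonempty_interior' _ (Set.nonempty_iff_ne_empty.2 hne)
    exact hf (ContinuousLinearMap.coe_injective (LinearMap.ker_eq_top.1 this))
  exact interior_eq_empty_iff_dense_compl.1 hker

/-- The transvection `x ↦ x + f x • v`, where `f v = 0`, as a continuous linear equivalence. -/
def continuousTransvection {𝕜 E : Type*} [NormedField 𝕜] [AddCommGroup E] [TopologicalSpace E]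
    [IsTopologicalAddGroup E] [Module 𝕜 E] [ContinuousSMul 𝕜 E] {f : StrongDual 𝕜 E} {v : E}
    (h : f v = 0) : E ≃L[𝕜] E where
  toLinearEquiv := LinearEquiv.transvection (f := (f : E →ₗ[𝕜] 𝕜)) h
  continuous_toFun := by
    change Continuous fun x => x + f x • v
    fun_prop
  continuous_invFun := by
    change Continuous fun x => x + f x • -v
    fun_prop

section DHypercyclic

variable {𝕜 E : Type*} [RCLike 𝕜] [NormedAddCommGroup E] [NormedSpace 𝕜 E] {N : ℕ}

theorem mem_dHypercyclicVectors_conj (A : Fin N → E →L[𝕜] E) (L : Fin N → E ≃L[𝕜] E) {x : E} :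
    x ∈ dHypercyclicVectors (fun i => (L i).symm.conjContinuousAlgEquiv (A i)) ↔
      Dense (Set.range fun (n : ℕ) i => (A i ^ n) (L i x)) := by
  have horbit (n : ℕ) (i : Fin N) :
      ((L i).symm.conjContinuousAlgEquiv (A i) ^ n) x = (L i).symm ((A i ^ n) (L i x)) := by
    rw [← map_pow]
    rfl
  have himage : Set.range (fun (n : ℕ) i => (L i).symm ((A i ^ n) (L i x))) =
      Homeomorph.piCongrRight (fun i => (L i).symm.toHomeomorph) ''
        Set.range fun (n : ℕ) i => (A i ^ n) (L i x) := by
    rw [← Set.range_comp]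
    rfl
  simp only [dHypercyclicVectors, Set.mem_ofPred_eq, horbit]
  exact himage ▸ (Homeomorph.isDenseEmbedding _).dense_image

/-- The conjugates `Tᵢ = Lᵢ⁻¹ A Lᵢ` of `A` by the transvections `Lᵢ x = x + f x • e i`. Their
orbits at `x` are those of `A` at `x + f x • e i`, so they differ only when `f x ≠ 0`. -/
def transvectionConj (A : E →L[𝕜] E) {f : StrongDual 𝕜 E} {e : Fin N → E} (he : ∀ i, f (e i) = 0)
    (i : Fin N) : E →L[𝕜] E :=
  (continuousTransvection (he i)).symm.conjContinuousAlgEquiv A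

variable {A : E →L[𝕜] E} {f : StrongDual 𝕜 E} {e : Fin N → E} {he : ∀ i, f (e i) = 0}

theorem mem_dHypercyclicVectors_transvectionConj {x : E} :
    x ∈ dHypercyclicVectors (transvectionConj A he) ↔
      Dense (Set.range fun (n : ℕ) i => (A ^ n) x + f x • (A ^ n) (e i)) := by
  have hshear (n : ℕ) (i : Fin N) :
      (A ^ n) (continuousTransvection (he i) x) = (A ^ n) x + f x • (A ^ n) (e i) := by
    rw [← map_smul, ← map_add]
    rfl
  simp only [← hshear]
  exact mem_dHypercyclicVectors_conj (fun _ => A) fun i => continuousTransvection (he i)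

theorem apply_ne_zero_of_mem_dHypercyclicVectors [Nontrivial (Fin N)] [Nontrivial E] {x : E}
    (hx : x ∈ dHypercyclicVectors (transvectionConj A he)) : f x ≠ 0 := by
  intro hfx
  rw [mem_dHypercyclicVectors_transvectionConj] at hx
  refine not_dense_of_subset_diagonal ?_ hx
  rintro _ ⟨n, rfl⟩ i j
  simp only [hfx, zero_smul]

theorem pow_apply_mem_dHypercyclicVectors {w : E}
    (hwe : Dense (Set.range fun (n : ℕ) (o : Option (Fin N)) => (A ^ n) (o.elim w e))) {k : ℕ}
    (hk : f ((A ^ k) w) ≠ 0) : (A ^ k) w ∈ dHypercyclicVectors (transvectionConj A he) := by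
  rw [mem_dHypercyclicVectors_transvectionConj]
  set c := f ((A ^ k) w)
  let G (z : Option (Fin N) → E) (i : Fin N) : E := (A ^ k) (z none) + c • z (some i)
  have hG_cont : Continuous G := by fun_prop
  have hG_surj : Function.Surjective G := fun y =>
    ⟨fun o => o.elim 0 fun i => c⁻¹ • y i, funext fun i => by simp [G, smul_inv_smul₀ hk]⟩
  convert hG_surj.denseRange.dense_image hG_cont hwe
  rw [← Set.range_comp]
  congr! with n i
  simp only [G, Function.comp_apply, Option.elim, ← mul_apply_eq_comp, ← pow_add, add_comm n k]

theorem denselyDHypercyclic_transvectionConj (hf : f ≠ 0) {w : E}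
    (hwe : Dense (Set.range fun (n : ℕ) (o : Option (Fin N)) => (A ^ n) (o.elim w e))) :
    DenselyDHypercyclic (transvectionConj A he) := by
  have horbit : Dense (Set.range fun k : ℕ => (A ^ k) w) := by
    have := (Function.surjective_eval (none : Option (Fin N))).denseRange.dense_image
      (continuous_apply none) hwe
    rwa [← Set.range_comp] at this
  have hopen : IsOpen {x | f x ≠ 0} := isOpen_ne_fun f.continuous continuous_const
  refine ((dense_setOf_strongDual_apply_ne_zero hf).inter_of_isOpen_left horbit hopen).mono ?_
  rintro _ ⟨hk, k, rfl⟩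
  exact pow_apply_mem_dHypercyclicVectors hwe hk

theorem IsDHypercyclicManifold.finrank_eq_one [Nontrivial (Fin N)] [Nontrivial E]
    {V : Submodule 𝕜 E} (hV : IsDHypercyclicManifold (transvectionConj A he) V) (hV0 : V ≠ ⊥) :
    Module.finrank 𝕜 V = 1 :=
  finrank_eq_one_of_forall_apply_ne_zero (f : E →ₗ[𝕜] 𝕜) hV0 fun x hx hx0 =>
    apply_ne_zero_of_mem_dHypercyclicVectors (hV x hx hx0)

end DHypercyclic

theorem corollary3p3 {𝕜 : Type*} [RCLike 𝕜] {X : Type*} [NormedAddCommGroup X]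
    [NormedSpace 𝕜 X] [CompleteSpace X] [TopologicalSpace.SeparableSpace X]
    (hX : ¬ FiniteDimensional 𝕜 X) (N : ℕ) (hN : 2 ≤ N) :
    ∃ T : Fin N → X →L[𝕜] X,
      DenselyDHypercyclic T ∧
      (¬ ∃ V : Submodule 𝕜 X, IsDHypercyclicManifold T V ∧ Dense (V : Set X)) ∧
      ∀ V : Submodule 𝕜 X, V ≠ ⊥ → (V : Set X) ⊆ dHypercyclicVectors T ∪ {0} →
        Module.finrank 𝕜 V = 1 := by
  have : Nontrivial X := not_subsingleton_iff_nontrivial.1 fun _ => hX inferInstance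
  have : Nontrivial (Fin N) := Fin.nontrivial_iff_two_le.2 hN
  have := UniformSpace.secondCountable_of_separable X
  obtain ⟨A, hA⟩ := exists_isTopologicallyMixing hX
  obtain ⟨v, hv⟩ := hA.exists_dense_joint_orbit A.continuous (Option (Fin N))
  obtain ⟨w, e, rfl⟩ : ∃ w e, v = fun o : Option (Fin N) => o.elim w e :=
    ⟨v none, v ∘ some, funext fun o => by cases o <;> rfl⟩
  obtain ⟨f, hf, hfe⟩ := exists_strongDual_ne_zero_of_finite hX (Set.finite_range e)
  have he (i : Fin N) : f (e i) = 0 := hfe _ ⟨i, rfl⟩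
  simp only [← FunLike.coe_pow_eq_iterate] at hv
  refine ⟨transvectionConj A he, denselyDHypercyclic_transvectionConj hf hv, ?_, ?_⟩
  · rintro ⟨V, hV, hV_dense⟩
    have hV0 : V ≠ ⊥ := by
      rintro rfl
      exact hX (finiteDimensional_of_dense_submodule hV_dense)
    have : FiniteDimensional 𝕜 V :=
      Module.finite_of_finrank_eq_succ (hV.finrank_eq_one hV0)
    exact hX (finiteDimensional_of_dense_submodule hV_dense)
  · intro V hV0 hV
    exact IsDHypercyclicManifold.finrank_eq_one
      (fun x hx hx0 => (hV hx).resolve_right hx0) hV0
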